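/- Let $p$ be a prime and let $K$ be a finite field extension of $\mathbb{Q}_p$. Let $v\colon K^\times\to\mathbb{Z}$ be the normalized (surjective) valuation of $K$, with $v(0)=\infty$, let $R=\{x\in K : v(x)\ge 0\}$ be its valuation ring and $R^*=R\setminus\{0\}$. Let $\pi\in K$ be any element with $v(\pi)=1$, and for each integer $k>0$ put $$R^{(k)}=\{x\in R : x\neq 0 \text{ and } v(\pi^{-v(x)}x-1)\ge k\}.$$ Regard $K$ as a structure for $\mathcal{L}_\pi$, the language of rings with one extra constant symbol, which denotes $\pi$. Here "definable" means defined by an $\mathcal{L}_\pi$-formula without further parameters. Definable sets $X\subset K^m$ and $Y\subset K^n$ are called isomorphic if there is a bijection $X\to Y$ whose graph is a definable subset of $K^{m+n}$. The union of two disjoint copies of $X\subset K^m$ is the set $\{0\}\times X\,\cup\,\{1\}\times X\subset K^{m+1}$. Then all the sets below are definable, and (i) for each integer $k>0$, the union of two disjoint copies of $R^{(k)}$ is isomorphic to $R^{(k)}$; (ii) the union of two disjoint copies of $R^*$ is isomorphic to $R^*$. -/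

import Mathlib

open FirstOrder Set
open scoped NNReal WithZero

namespace PadicDef

/-! ### Definable isomorphisms in a first-order structure -/

section Definable

variable (L : Language) {M : Type*} [L.Structure M]

/-- The set `X ⊆ M^m` is `L`-definable: it is defined by an `L`-formula without parameters
(the constants named in `L` may of course be used). -/
def IsDefinable {m : ℕ} (X : Set (Fin m → M)) : Prop :=
  (∅ : Set M).Definable L X

/-- The graph of `f : X → Y`, with `X ⊆ M^m` and `Y ⊆ M^n`, as a subset of `M^(m + n)`. -/
def graphOf {M : Type*} {m n : ℕ} {X : Set (Fin m → M)} {Y : Set (Fin n → M)} (f : X → Y) :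
    Set (Fin (m + n) → M) :=
  {z | ∃ x : X, z = Fin.append (x : Fin m → M) (f x : Fin n → M)}

/-- `X ≅ Y`: both sets are `L`-definable and there is a bijection `X → Y` with `L`-definable
graph. -/
def Isomorphic {m n : ℕ} (X : Set (Fin m → M)) (Y : Set (Fin n → M)) : Prop :=
  IsDefinable L X ∧ IsDefinable L Y ∧
    ∃ f : X → Y, Function.Bijective f ∧ IsDefinable L (graphOf f)

/-- The union of two disjoint copies of `X ⊆ M^m`, namely
`{0} × X ∪ {1} × X ⊆ M^(m + 1)`. -/
def twoCopies {M : Type*} [Zero M] [One M] {m : ℕ} (X : Set (Fin m → M)) :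
    Set (Fin (m + 1) → M) :=
  {z | (z 0 = 0 ∨ z 0 = 1) ∧ Fin.tail z ∈ X}

/-- A subset of `M`, regarded as a subset of `M^1`. -/
def asPower {M : Type*} (X : Set M) : Set (Fin 1 → M) :=
  {z | z 0 ∈ X}

end Definable

/-! ### The language of rings with a constant symbol for a uniformizer -/

/-- The language of rings with one additional constant symbol. -/
abbrev ringConst : Language := Language.ring.withConstants Unit

/-- The field `K` as a structure for the language of rings with one additional constant symbol:
the ring symbols have their usual meaning and the constant symbol denotes `π`. -/
@[reducible] noncomputable def ringConstStructure {K : Type*} [Field K] (π : K) :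
    ringConst.Structure K :=
  letI : Ring.CompatibleRing K := Ring.compatibleRingOfRing K
  letI : (Language.constantsOn Unit).Structure K :=
    Language.constantsOn.structure (fun _ : Unit => π)
  Language.withConstantsStructure Language.ring Unit

/-! ### The normalized valuation of a finite extension of `ℚ_p` -/

section Valuation

variable (p : ℕ) [Fact p.Prime] (K : Type*) [Field K] [Algebra ℚ_[p] K] [FiniteDimensional ℚ_[p] K]

/-- The unique extension to `K` of the `p`-adic absolute value, as a valuation with values
in `ℝ≥0`. -/
noncomputable def absValuation : Valuation K ℝ≥0 where
  toFun x := ⟨spectralNorm ℚ_[p] K x, spectralNorm_nonneg x⟩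
  map_zero' := Subtype.ext spectralNorm_zero
  map_one' := Subtype.ext spectralNorm_one
  map_mul' x y := Subtype.ext (map_mul (spectralMulAlgNorm ℚ_[p] K) x y)
  map_add_le_max' x y := isNonarchimedean_spectralNorm x y

/-- The valuation ring `{x | |x| ≤ 1}` of `K` is a discrete valuation ring. -/
instance isDiscreteValuationRing_absValuation :
    IsDiscreteValuationRing (absValuation p K).valuationSubring := by
  let : NontriviallyNormedField K := spectralNorm.nontriviallyNormedField ℚ_[p] K
  let : NormedAlgebra ℚ_[p] K := spectralNorm.normedAlgebra ℚ_[p] K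
  have : IsUltrametricDist K :=
    IsUltrametricDist.isUltrametricDist_of_isNonarchimedean_norm isNonarchimedean_spectralNorm
  have : ProperSpace K := FiniteDimensional.proper ℚ_[p] K
  let : Valued K ℝ≥0 := NormedField.toValued
  have hc : IsCompact ((Valued.integer K : Subring K) : Set K) := by
    have : ((Valued.integer K : Subring K) : Set K) = Metric.closedBall 0 1 := by
      ext x; simp [Valued.integer.mem_iff]
    rw [this]
    exact isCompact_closedBall 0 1
  have : CompactSpace (Valued.integer K) := isCompact_iff_compactSpace.mp hc
  have : (Valued.v : Valuation K ℝ≥0).IsNontrivial := by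
    obtain ⟨x, hx0, hx1⟩ := NormedField.exists_norm_lt_one K
    refine ⟨x, ?_, ?_⟩
    · simpa using norm_pos_iff.mp hx0
    · intro h
      have : ‖x‖ = 1 := congrArg NNReal.toReal h
      exact hx1.ne this
  exact Valued.integer.isDiscreteValuationRing_of_compactSpace (K := K)

/-- The normalized discrete valuation of `K`, written multiplicatively with values in `ℤᵐ⁰`:
`v(x) = n` for the additively written valuation means `normVal p K x = exp (-n)`, and
`v(x) ≥ n` (with `v(0) = ∞`) means `normVal p K x ≤ exp (-n)`. -/
noncomputable def normVal : Valuation K ℤᵐ⁰ :=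
  (IsDiscreteValuationRing.maximalIdeal (absValuation p K).valuationSubring).valuation K

/-- The additively written normalized valuation `v(x) ∈ ℤ` of a nonzero `x ∈ K`
(only used for `x ≠ 0`). -/
noncomputable def ord (x : K) : ℤ := -WithZero.log (normVal p K x)

/-- The valuation ring `R = {x ∈ K | v(x) ≥ 0}`. -/
def valRing : Set K := {x | normVal p K x ≤ WithZero.exp 0}

/-- `R^* = R \ {0}`. -/
def valRingStar : Set K := valRing p K \ {0}

variable {K}

/-- `X^(k) = {x ∈ X | x ≠ 0 and v(π^(-v(x)) x - 1) ≥ k}`. -/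
def higher (π : K) (X : Set K) (k : ℕ) : Set K :=
  {x ∈ X | x ≠ 0 ∧ normVal p K (π ^ (-ord p K x) * x - 1) ≤ WithZero.exp (-(k : ℤ))}

end Valuation

end PadicDef

open PadicDef

/-! Let `q` be the order of the residue field and `n = 2q - 1`. Since `n ≡ 1` mod `q - 1`, the map
`u ↦ u ^ n` fixes residues of units; since `n ≡ -1` mod `q`, it is an isometry on each residue disc
of units. A Newton iteration gives surjectivity, so `u ↦ u ^ n` permutes the unit group and each `1
+ π ^ k R` with `k > 0` (`pow_exponent_injOn`, `exists_root`, `powSurjOn_higherUnits`).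

Both `R^*` and `R^(k)` have the form `natSpan π G`: the elements `π ^ m * u` with `m ≥ 0` and `u` in
such a group `G`. Put `d = n - 1`. The bijection `foldMap` is a Hilbert hotel on the exponent `m`
that uses only definable operations. Because `n ≡ 1` mod `d`, the power `x ^ n` has exponent
congruent to `m` mod `d`. On copy 0, dividing it by `π ^ (m % d)` gives the exponent `d * s` with `s
= n * (m / d) + m % d`, and these are all `s` whose residue mod `n` is not `d`. On copy 1, the
elements with `d ∣ m` go to the exponents `d * s` with `s ≡ d` mod `n`, and the others stay fixed,
filling the exponents not divisible by `d`. The unit becomes `u ^ n` or stays `u`.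

Definability rests on three algebraic descriptions: of the valuation ring (`mem_valRing_iff`), of
`R^(k)` (`mem_natSpan_higherUnits_iff`), and of the valuation mod `d` (`ordModEq_iff`). They make
the graph first-order through `eq_foldMap_iff`. -/

/-- The properties of a normalized discrete valuation with uniformizer `π` and residue field of
`q` elements, complete in the sense of a fixed point principle on residue discs. -/
structure PadicLike {K : Type*} [Field K] (v : Valuation K ℤᵐ⁰) (π : K) (q : ℕ) : Prop where
  map_unif : v π = WithZero.exp (-1)
  two_le : 2 ≤ q
  map_card : v (q : K) < 1
  frob : ∀ x, v x ≤ 1 → v (x ^ q - x) < 1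
  fixedPoint : ∀ (u : K) (f : K → K), (∀ z, v (z - u) < 1 → v (f z - u) < 1) →
    (∀ z w, v (z - u) < 1 → v (w - u) < 1 → v (f z - f w) ≤ WithZero.exp (-1) * v (z - w)) →
    ∃ z, v (z - u) < 1 ∧ f z = z

namespace PadicLike

theorem le_exp_neg_one_iff {a : ℤᵐ⁰} : a ≤ WithZero.exp (-1) ↔ a < 1 := by
  rcases eq_or_ne a 0 with rfl | ha
  · simp
  · rw [← WithZero.exp_log ha, ← WithZero.exp_zero, WithZero.exp_le_exp, WithZero.exp_lt_exp]
    omega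

/-! ### Power maps on residue discs -/

section General

variable {K : Type*} [Field K] (v : Valuation K ℤᵐ⁰)

theorem map_eq_one_of_sub_lt {x y : K} (hy : v y = 1) (h : v (x - y) < 1) : v x = 1 := by
  have := v.map_add_eq_of_lt_right (x := x - y) (y := y) (by rwa [hy])
  rwa [sub_add_cancel, hy] at this

theorem sub_lt_one_trans {x y z : K} (h : v (x - y) < 1) (h' : v (y - z) < 1) :
    v (x - z) < 1 := by
  have := v.map_add_lt h h'
  rwa [sub_add_sub_cancel] at this

theorem map_pow_sub_pow_le {z w : K} (hz : v z ≤ 1) (hw : v w ≤ 1) (i : ℕ) :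
    v (z ^ i - w ^ i) ≤ v (z - w) := by
  rw [← geom_sum₂_mul, map_mul]
  refine mul_le_of_le_one_left' (v.map_sum_le fun j _ => ?_)
  rw [map_mul, map_pow, map_pow]
  exact mul_le_one' (pow_le_one' hz _) (pow_le_one' hw _)

/-- The sum is the divided difference of `X ^ n`; on the residue disc of `u` it agrees with the
derivative at `u` modulo the maximal ideal. -/
theorem geom_sum_sub_lt {z w u : K} (hu : v u = 1) (hz : v (z - u) < 1) (hw : v (w - u) < 1)
    (n : ℕ) :
    v (∑ i ∈ Finset.range n, z ^ i * w ^ (n - 1 - i) - n * u ^ (n - 1)) < 1 := by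
  have hz1 := map_eq_one_of_sub_lt v hu hz
  have hw1 := map_eq_one_of_sub_lt v hu hw
  have : (n : K) * u ^ (n - 1) = ∑ _i ∈ Finset.range n, u ^ (n - 1) := by simp
  rw [this, ← Finset.sum_sub_distrib]
  refine v.map_sum_lt one_ne_zero fun i hi => ?_
  have hi' : u ^ (n - 1) = u ^ i * u ^ (n - 1 - i) := by
    rw [← pow_add]; congr 1; have := Finset.mem_range.1 hi; omega
  rw [hi', show z ^ i * w ^ (n - 1 - i) - u ^ i * u ^ (n - 1 - i) =
    z ^ i * (w ^ (n - 1 - i) - u ^ (n - 1 - i)) + (z ^ i - u ^ i) * u ^ (n - 1 - i) by ring]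
  refine v.map_add_lt ?_ ?_
  · rw [map_mul, map_pow, hz1, one_pow, one_mul]
    exact (map_pow_sub_pow_le v hw1.le hu.le _).trans_lt hw
  · rw [map_mul, map_pow, hu, one_pow, mul_one]
    exact (map_pow_sub_pow_le v hz1.le hu.le _).trans_lt hz

/-- When `n` is a unit the divided difference is a unit too, so the power map is an isometry on
residue discs of units. -/
theorem map_pow_sub_pow_eq {n : ℕ} (hn : v (n : K) = 1) {z w : K} (hw : v w = 1)
    (h : v (z - w) < 1) : v (z ^ n - w ^ n) = v (z - w) := by
  rw [← geom_sum₂_mul, map_mul, map_eq_one_of_sub_lt v _ (geom_sum_sub_lt v hw h (by simp) n),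
    one_mul]
  rw [map_mul, map_pow, hn, hw, one_pow, one_mul]

end General

/-! ### The exponent `2 * q - 1` and the description of the valuation ring -/

variable {K : Type*} [Field K] {v : Valuation K ℤᵐ⁰} {π : K} {q : ℕ} (h : PadicLike v π q)

include h

theorem unif_ne_zero : π ≠ 0 := by
  intro h0
  have := h.map_unif
  rw [h0, map_zero] at this
  exact WithZero.exp_ne_zero this.symm

theorem map_zpow_unif (m : ℤ) : v (π ^ m) = WithZero.exp (-m) := by
  rw [map_zpow₀, h.map_unif, ← WithZero.exp_zsmul]; simp

theorem map_pow_unif (m : ℕ) : v (π ^ m) = WithZero.exp (-(m : ℤ)) := by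
  rw [← zpow_natCast, h.map_zpow_unif]

theorem map_exponent : v ((2 * q - 1 : ℕ) : K) = 1 := by
  have h2 := h.two_le
  rw [Nat.cast_sub (by omega)]
  have h1 : v ((q : K) + q) < 1 := v.map_add_lt h.map_card h.map_card
  -- The negative of `2q - 1` is congruent to 1 modulo the maximal ideal.
  refine (v.map_neg _).symm.trans (map_eq_one_of_sub_lt v (y := 1) (by simp) ?_)
  rw [← v.map_neg]
  convert h1 using 2
  push_cast; ring

theorem map_pow_pred_sub_one_lt {x : K} (hx : v x = 1) : v (x ^ (q - 1) - 1) < 1 := by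
  have h1 := h.frob x hx.le
  have h2 := h.two_le
  obtain ⟨m, rfl⟩ : ∃ m, q = m + 1 := ⟨q - 1, by omega⟩
  rw [show x ^ (m + 1) - x = x * (x ^ m - 1) by ring, map_mul, hx, one_mul] at h1
  simpa using h1

theorem map_pow_exponent_sub_lt {x : K} (hx : v x = 1) : v (x ^ (2 * q - 1) - x) < 1 := by
  have h2 := h.two_le
  have h1 := h.map_pow_pred_sub_one_lt hx
  obtain ⟨m, rfl⟩ : ∃ m, q = m + 1 := ⟨q - 1, by omega⟩
  simp only [Nat.add_sub_cancel] at h1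
  rw [show 2 * (m + 1) - 1 = m + m + 1 by omega,
    show x ^ (m + m + 1) - x = x * (x ^ m + 1) * (x ^ m - 1) by ring, map_mul, map_mul, hx, one_mul]
  refine (mul_le_of_le_one_left' (v.map_add_le ?_ (by simp))).trans_lt h1
  rw [map_pow, hx, one_pow]

theorem pow_exponent_injOn : {x : K | v x = 1}.InjOn (fun x => x ^ (2 * q - 1)) := by
  intro x hx y hy hxy
  have h1 : v (x - y) < 1 := by
    refine sub_lt_one_trans v (y := x ^ (2 * q - 1)) ?_ ?_
    · rw [v.map_sub_swap]; exact h.map_pow_exponent_sub_lt hx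
    · rw [show x ^ (2 * q - 1) = y ^ (2 * q - 1) from hxy]; exact h.map_pow_exponent_sub_lt hy
  have h2 := map_pow_sub_pow_eq v h.map_exponent hy h1
  rw [show x ^ (2 * q - 1) = y ^ (2 * q - 1) from hxy, sub_self, map_zero] at h2
  exact sub_eq_zero.1 (v.zero_iff.1 h2.symm)

/-- Newton's iteration with the derivative frozen at `u`: as `u ^ n ≡ u`, the point `u` is already
an approximate root, and the iteration contracts its residue disc. -/
theorem exists_root {u : K} (hu : v u = 1) : ∃ z, v (z - u) < 1 ∧ z ^ (2 * q - 1) = u := by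
  set n := 2 * q - 1 with hn
  set c := ((n : K) * u ^ (n - 1))⁻¹ with hc
  have hn1 : v (n : K) = 1 := h.map_exponent
  have hd1 : v ((n : K) * u ^ (n - 1)) = 1 := by rw [map_mul, map_pow, hn1, hu]; simp
  have hd0 : (n : K) * u ^ (n - 1) ≠ 0 := by
    intro h0; rw [h0, map_zero] at hd1; exact zero_ne_one hd1
  have hc1 : v c = 1 := by rw [hc, map_inv₀, hd1, inv_one]
  have hc0 : c ≠ 0 := inv_ne_zero hd0
  obtain ⟨z, hz, hfz⟩ := h.fixedPoint u (fun z => z - c * (z ^ n - u)) (fun z hz => by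
      rw [show z - c * (z ^ n - u) - u = (z - u) + -(c * (z ^ n - u)) by ring]
      refine v.map_add_lt hz ?_
      rw [v.map_neg, map_mul, hc1, one_mul]
      exact sub_lt_one_trans v (h.map_pow_exponent_sub_lt (map_eq_one_of_sub_lt v hu hz)) hz)
    (fun z w hz hw => by
      have key : z - c * (z ^ n - u) - (w - c * (w ^ n - u)) =
          -c * (∑ i ∈ Finset.range n, z ^ i * w ^ (n - 1 - i) - n * u ^ (n - 1)) * (z - w) := by
        have h1 := geom_sum₂_mul z w n
        have h2 : c * ((n : K) * u ^ (n - 1)) = 1 := inv_mul_cancel₀ hd0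
        linear_combination (c * h1) - h2 * (z - w)
      rw [key, map_mul, map_mul, v.map_neg, hc1, one_mul]
      exact mul_le_mul_left (le_exp_neg_one_iff.2 (geom_sum_sub_lt v hu hz hw n)) _)
  refine ⟨z, hz, ?_⟩
  have h3 : c * (z ^ n - u) = 0 := by linear_combination -hfz
  exact sub_eq_zero.1 ((mul_eq_zero.1 h3).resolve_left hc0)

/-- For integral `x` the right side is a unit congruent to 1, hence an `n`-th power. If `x` has a
pole, the term `π * x ^ n` dominates, and its valuation is 1 mod `n`, so it cannot be that of an
`n`-th power. -/
theorem mem_valRing_iff (x : K) : v x ≤ 1 ↔ ∃ y, y ^ (2 * q - 1) = 1 + π * x ^ (2 * q - 1) := by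
  have h2 := h.two_le
  constructor
  · intro hx
    have h1 : v (1 + π * x ^ (2 * q - 1)) = 1 := by
      refine map_eq_one_of_sub_lt v (y := 1) (by simp) ?_
      rw [add_sub_cancel_left, map_mul, map_pow, ← le_exp_neg_one_iff, h.map_unif]
      exact mul_le_of_le_one_right' (pow_le_one' hx _)
    obtain ⟨z, -, hz⟩ := h.exists_root h1
    exact ⟨z, hz⟩
  · rintro ⟨y, hy⟩
    by_contra! hx
    have hx0 : v x ≠ 0 := (zero_lt_one.trans hx).ne'
    have hlog : 0 < WithZero.log (v x) := by
      rw [← WithZero.exp_log hx0, ← WithZero.exp_zero, WithZero.exp_lt_exp] at hx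
      exact hx
    have h1 : v (π * x ^ (2 * q - 1)) = WithZero.exp (-1 + (2 * q - 1 : ℕ) * WithZero.log (v x)) := by
      rw [map_mul, map_pow, h.map_unif, WithZero.exp_add]
      conv_lhs => rw [← WithZero.exp_log hx0, ← WithZero.exp_nsmul]
      simp
    have hpos : 1 < v (π * x ^ (2 * q - 1)) := by
      rw [h1, ← WithZero.exp_zero, WithZero.exp_lt_exp]
      have : (2 : ℤ) * 1 ≤ (2 * q - 1 : ℕ) * WithZero.log (v x) :=
        mul_le_mul (by omega) (by omega) (by omega) (by omega)
      omega
    have h3 := v.map_add_eq_of_lt_right (x := 1) (y := π * x ^ (2 * q - 1)) (by simpa using hpos)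
    rw [← hy, h1, map_pow] at h3
    have h4 := congrArg WithZero.log h3
    rw [WithZero.log_pow, WithZero.log_exp, nsmul_eq_mul] at h4
    have h5 : ((2 * q - 1 : ℕ) : ℤ) ∣ 1 :=
      ⟨WithZero.log (v x) - WithZero.log (v y), by rw [mul_sub]; linarith⟩
    have := Int.le_of_dvd one_pos h5
    omega

/-- The power `q - 1` lands in `1 + π R`. Each further `q`-th power gains a factor of valuation at
least 1, because the divided difference of `X ^ q` near 1 is congruent to `q`, hence to 0. -/
theorem map_pow_sub_one_le {x : K} (hx : v x = 1) (k : ℕ) :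
    v (x ^ ((q - 1) * q ^ k) - 1) ≤ WithZero.exp (-((k + 1 : ℕ) : ℤ)) := by
  induction k with
  | zero =>
    simpa using le_exp_neg_one_iff.2 (h.map_pow_pred_sub_one_lt hx)
  | succ k ih =>
    have h1 : v (x ^ ((q - 1) * q ^ k) - 1) < 1 := by
      refine ih.trans_lt ?_
      rw [← WithZero.exp_zero, WithZero.exp_lt_exp]; omega
    have h2 := geom_sum_sub_lt v (z := x ^ ((q - 1) * q ^ k)) (w := 1) (u := 1) (by simp) h1
      (by simp) q
    have h3 := v.map_add_lt h2 h.map_card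
    rw [one_pow, mul_one, sub_add_cancel, ← le_exp_neg_one_iff] at h3
    have h4 := geom_sum₂_mul (x ^ ((q - 1) * q ^ k)) 1 q
    rw [one_pow] at h4
    rw [pow_succ, ← mul_assoc, pow_mul, ← h4, map_mul]
    refine (mul_le_mul' h3 ih).trans ?_
    rw [← WithZero.exp_add, WithZero.exp_le_exp]
    push_cast; omega

/-! ### Elements as a power of the uniformizer times a unit -/

theorem exists_eq_zpow_mul {x : K} (hx : x ≠ 0) :
    ∃ m : ℤ, ∃ u, v u = 1 ∧ x = π ^ m * u := by
  have hx0 : v x ≠ 0 := v.ne_zero_iff.2 hx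
  have hp := zpow_ne_zero (-WithZero.log (v x)) h.unif_ne_zero
  refine ⟨-WithZero.log (v x), (π ^ (-WithZero.log (v x)))⁻¹ * x, ?_, by field_simp⟩
  rw [map_mul, map_inv₀, h.map_zpow_unif, neg_neg, WithZero.exp_log hx0, inv_mul_cancel₀ hx0]

theorem log_zpow_mul (m : ℤ) {u : K} (hu : v u = 1) : -WithZero.log (v (π ^ m * u)) = m := by
  rw [map_mul, hu, mul_one, h.map_zpow_unif, WithZero.log_exp, neg_neg]

/-- The elements `π ^ m * u` with `m ∈ ℕ` and `u ∈ G`. -/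
def _root_.natSpan {K : Type*} [Field K] (π : K) (G : Set K) : Set K :=
  {x | ∃ m : ℕ, ∃ u ∈ G, x = π ^ m * u}

theorem nonneg_of_map_le {m : ℤ} {u : K} (hu : v u = 1) (hx : v (π ^ m * u) ≤ 1) : 0 ≤ m := by
  rw [map_mul, hu, mul_one, h.map_zpow_unif, ← WithZero.exp_zero, WithZero.exp_le_exp] at hx
  omega

theorem natSpan_units : natSpan π {u | v u = 1} = {x | v x ≤ 1 ∧ x ≠ 0} := by
  ext x
  constructor
  · rintro ⟨m, u, hu, rfl⟩
    refine ⟨?_, mul_ne_zero (pow_ne_zero _ h.unif_ne_zero) (v.ne_zero_iff.1 ?_)⟩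
    · rw [map_mul, show v u = 1 from hu, mul_one, h.map_pow_unif, ← WithZero.exp_zero,
        WithZero.exp_le_exp]
      omega
    · rw [show v u = 1 from hu]; exact one_ne_zero
  · rintro ⟨hx, hx0⟩
    obtain ⟨m, u, hu, rfl⟩ := h.exists_eq_zpow_mul hx0
    have hm := h.nonneg_of_map_le hu hx
    exact ⟨m.toNat, u, hu, by rw [← zpow_natCast, Int.toNat_of_nonneg hm]⟩

omit h in
theorem map_eq_one_of_sub_one_le {k : ℕ} (hk : 0 < k) {u : K}
    (hu : v (u - 1) ≤ WithZero.exp (-(k : ℤ))) : v u = 1 := by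
  refine map_eq_one_of_sub_lt v (y := 1) (by simp) (hu.trans_lt ?_)
  rw [← WithZero.exp_zero, WithZero.exp_lt_exp]; omega

theorem natSpan_higherUnits {k : ℕ} (hk : 0 < k) :
    natSpan π {u | v (u - 1) ≤ WithZero.exp (-(k : ℤ))} =
      {x | v x ≤ 1 ∧ x ≠ 0 ∧ v (π ^ (WithZero.log (v x)) * x - 1) ≤ WithZero.exp (-(k : ℤ))} := by
  have key : ∀ (m : ℤ) (u : K), v u = 1 → π ^ (WithZero.log (v (π ^ m * u))) * (π ^ m * u) = u := by
    intro m u hu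
    rw [← neg_neg (WithZero.log _), h.log_zpow_mul m hu, ← mul_assoc,
      ← zpow_add₀ h.unif_ne_zero, neg_add_cancel, zpow_zero, one_mul]
  ext x
  constructor
  · rintro ⟨m, u, hu, rfl⟩
    have hu1 := map_eq_one_of_sub_one_le hk hu
    have hx : π ^ m * u ∈ natSpan π {u | v u = 1} := ⟨m, u, hu1, rfl⟩
    rw [h.natSpan_units] at hx
    refine ⟨hx.1, hx.2, ?_⟩
    rw [← zpow_natCast, key _ _ hu1]
    exact hu
  · rintro ⟨hx, hx0, hk'⟩
    obtain ⟨m, u, hu, rfl⟩ := h.exists_eq_zpow_mul hx0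
    have hm := h.nonneg_of_map_le hu hx
    rw [key _ _ hu] at hk'
    exact ⟨m.toNat, u, hk', by rw [← zpow_natCast, Int.toNat_of_nonneg hm]⟩

/-- With `M = (q - 1) * q ^ k`, the `M`-th power of a unit lies in `1 + π ^ (k + 1) R`, so `y ^ M`
can supply an arbitrary multiple of `M` in the exponent without disturbing the unit part. The
remaining exponent is one of finitely many `i`, which a formula can list. -/
theorem mem_natSpan_higherUnits_iff (k : ℕ) (x : K) :
    x ∈ natSpan π {u | v (u - 1) ≤ WithZero.exp (-((k + 1 : ℕ) : ℤ))} ↔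
      v x ≤ 1 ∧ x ≠ 0 ∧ ∃ i < (q - 1) * q ^ k, ∃ y z, v z ≤ 1 ∧
        x = (1 + π ^ (k + 1) * z) * π ^ i * y ^ ((q - 1) * q ^ k) := by
  have h2 := h.two_le
  have hM : 0 < (q - 1) * q ^ k := by
    have : 0 < q - 1 := by omega
    positivity
  have hz_iff : ∀ z : K, v (π ^ (k + 1) * z) ≤ WithZero.exp (-((k + 1 : ℕ) : ℤ)) ↔ v z ≤ 1 := by
    intro z
    rw [map_mul, h.map_pow_unif]
    exact mul_le_iff_le_one_right (WithZero.exp_pos)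
  constructor
  · intro hx
    have hx' := hx
    rw [h.natSpan_higherUnits k.succ_pos] at hx'
    obtain ⟨m, u, hu, rfl⟩ := hx
    refine ⟨hx'.1, hx'.2.1, m % ((q - 1) * q ^ k), Nat.mod_lt _ hM, π ^ (m / ((q - 1) * q ^ k)),
      (π ^ (k + 1))⁻¹ * (u - 1), ?_, ?_⟩
    · rw [← hz_iff, mul_inv_cancel_left₀ (pow_ne_zero _ h.unif_ne_zero)]
      exact hu
    · rw [mul_inv_cancel_left₀ (pow_ne_zero _ h.unif_ne_zero), mul_assoc, ← pow_mul, ← pow_add,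
        mul_comm (m / _), Nat.mod_add_div]
      ring
  · rintro ⟨hx, hx0, i, -, y, z, hz, rfl⟩
    have hy : y ≠ 0 := by
      rintro rfl
      rw [zero_pow hM.ne', mul_zero] at hx0
      exact hx0 rfl
    obtain ⟨m, u, hu, rfl⟩ := h.exists_eq_zpow_mul hy
    set M := (q - 1) * q ^ k with hMdef
    have hw : v (1 + π ^ (k + 1) * z - 1) ≤ WithZero.exp (-((k + 1 : ℕ) : ℤ)) := by
      rw [add_sub_cancel_left, hz_iff]; exact hz
    have hw1 := map_eq_one_of_sub_one_le k.succ_pos hw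
    have huM := h.map_pow_sub_one_le hu k
    rw [← hMdef] at huM
    have huw : v ((1 + π ^ (k + 1) * z) * u ^ M - 1) ≤ WithZero.exp (-((k + 1 : ℕ) : ℤ)) := by
      rw [show (1 + π ^ (k + 1) * z) * u ^ M - 1 =
        (1 + π ^ (k + 1) * z) * (u ^ M - 1) + (1 + π ^ (k + 1) * z - 1) by ring]
      refine v.map_add_le ?_ hw
      rwa [map_mul, hw1, one_mul]
    have huw1 := map_eq_one_of_sub_one_le k.succ_pos huw
    have heq : (1 + π ^ (k + 1) * z) * π ^ i * (π ^ m * u) ^ M =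
        π ^ ((i : ℤ) + m * M) * ((1 + π ^ (k + 1) * z) * u ^ M) := by
      rw [zpow_add₀ h.unif_ne_zero, zpow_mul, zpow_natCast, zpow_natCast, mul_pow]
      ring
    rw [heq] at hx ⊢
    have hm := h.nonneg_of_map_le huw1 hx
    exact ⟨((i : ℤ) + m * M).toNat, _, huw, by rw [← zpow_natCast π (Int.toNat _), Int.toNat_of_nonneg hm]⟩

end PadicLike

/-! ### Closure properties of terms and definable predicates -/

section Definability

open Language

variable {K : Type*} [Field K]

/-- `P` is a definable predicate of the tuple `w`. -/
def DefPred (π : K) {α : Type} (P : (α → K) → Prop) : Prop :=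
  letI : ringConst.Structure K := ringConstStructure π
  (∅ : Set K).Definable ringConst {w | P w}

/-- `f` is given by a term in the variables `w`. -/
def TermFun (π : K) {α : Type} (f : (α → K) → K) : Prop :=
  letI : ringConst.Structure K := ringConstStructure π
  ∃ t : ringConst.Term α, ∀ w, t.realize w = f w

namespace TermFun

variable {π : K} {α : Type} {f g : (α → K) → K}

theorem var (i : α) : TermFun π (fun w => w i) := ⟨.var i, fun _ => rfl⟩

theorem unif : TermFun π (fun _ : α → K => π) :=
  ⟨.func (Sum.inr (() : Unit) : ringConst.Functions 0) default, fun _ => rfl⟩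

theorem one : TermFun π (fun _ : α → K => 1) :=
  ⟨.func (Sum.inl Ring.oneFunc : ringConst.Functions 0) default, fun _ => rfl⟩

theorem zero : TermFun π (fun _ : α → K => 0) :=
  ⟨.func (Sum.inl Ring.zeroFunc : ringConst.Functions 0) default, fun _ => rfl⟩

theorem add (hf : TermFun π f) (hg : TermFun π g) : TermFun π (fun w => f w + g w) := by
  obtain ⟨s, hs⟩ := hf
  obtain ⟨t, ht⟩ := hg
  exact ⟨Functions.apply₂ (Sum.inl Ring.addFunc : ringConst.Functions 2) s t,
    fun w => congrArg₂ (· + ·) (hs w) (ht w)⟩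

theorem mul (hf : TermFun π f) (hg : TermFun π g) : TermFun π (fun w => f w * g w) := by
  obtain ⟨s, hs⟩ := hf
  obtain ⟨t, ht⟩ := hg
  exact ⟨Functions.apply₂ (Sum.inl Ring.mulFunc : ringConst.Functions 2) s t,
    fun w => congrArg₂ (· * ·) (hs w) (ht w)⟩

theorem pow (hf : TermFun π f) (n : ℕ) : TermFun π (fun w => f w ^ n) := by
  induction n with
  | zero => simpa using one
  | succ n ih => simpa only [pow_succ] using ih.mul hf

/-- Renaming variables carries a term under a quantifier, where `e` is `Sum.inl`. -/
theorem comp {β : Type} (hf : TermFun π f) (e : α → β) : TermFun π (fun w => f (w ∘ e)) := by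
  obtain ⟨s, hs⟩ := hf
  let : ringConst.Structure K := ringConstStructure π
  exact ⟨s.relabel e, fun w => by rw [Term.realize_relabel, hs]⟩

end TermFun

namespace DefPred

variable {π : K} {α : Type} {P Q : (α → K) → Prop} {f g : (α → K) → K}

theorem congr (hP : DefPred π P) (h : ∀ w, Q w ↔ P w) : DefPred π Q := by
  have : Q = P := funext fun w => propext (h w)
  rwa [this]

theorem eq (hf : TermFun π f) (hg : TermFun π g) : DefPred π (fun w => f w = g w) := by
  obtain ⟨s, hs⟩ := hf
  obtain ⟨t, ht⟩ := hg
  let : ringConst.Structure K := ringConstStructure π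
  refine empty_definable_iff.2 ⟨s.equal t, ?_⟩
  ext w
  simp [Formula.realize_equal, hs, ht]

theorem and (hP : DefPred π P) (hQ : DefPred π Q) : DefPred π (fun w => P w ∧ Q w) :=
  letI : ringConst.Structure K := ringConstStructure π
  Definable.inter hP hQ

theorem or (hP : DefPred π P) (hQ : DefPred π Q) : DefPred π (fun w => P w ∨ Q w) :=
  letI : ringConst.Structure K := ringConstStructure π
  Definable.union hP hQ

theorem not (hP : DefPred π P) : DefPred π (fun w => ¬ P w) :=
  letI : ringConst.Structure K := ringConstStructure π
  Definable.compl hP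

theorem ex {P : (α → K) → K → Prop}
    (hP : DefPred π (fun w : α ⊕ Unit → K => P (w ∘ Sum.inl) (w (Sum.inr ())))) :
    DefPred π (fun w => ∃ x, P w x) := by
  let : ringConst.Structure K := ringConstStructure π
  have h1 : DefPred π (fun w : α → K => ∃ u : Unit → K, P w (u ())) :=
    Definable.exists_of_finite hP
  exact h1.congr fun w => ⟨fun ⟨x, hx⟩ => ⟨fun _ => x, hx⟩, fun ⟨u, hu⟩ => ⟨u (), hu⟩⟩

theorem exists_lt {P : ℕ → (α → K) → Prop} (hP : ∀ i, DefPred π (P i)) (n : ℕ) :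
    DefPred π (fun w => ∃ i < n, P i w) := by
  induction n with
  | zero =>
    -- The empty disjunction is expressed by the false equation `0 = 1`.
    refine (eq (TermFun.zero (α := α) (π := π)) TermFun.one).congr fun w => ?_
    simp
  | succ n ih =>
    refine (ih.or (hP n)).congr fun w => ?_
    constructor
    · rintro ⟨i, hi, h⟩
      rcases Nat.lt_succ_iff_lt_or_eq.1 hi with hi | rfl
      · exact Or.inl ⟨i, hi, h⟩
      · exact Or.inr h
    · rintro (⟨i, hi, h⟩ | h)
      · exact ⟨i, by omega, h⟩
      · exact ⟨n, by omega, h⟩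

end DefPred
end Definability

/-! ### Finite extensions of the `p`-adic numbers are `PadicLike` -/

section LocalField

variable (p : ℕ) [Fact p.Prime] (K : Type*) [Field K] [Algebra ℚ_[p] K] [FiniteDimensional ℚ_[p] K]

variable {K} in
theorem normVal_le_one_iff (x : K) : normVal p K x ≤ 1 ↔ spectralNorm ℚ_[p] K x ≤ 1 := by
  have hA : x ∈ (absValuation p K).valuationSubring ↔ spectralNorm ℚ_[p] K x ≤ 1 := Iff.rfl
  rw [← hA]
  constructor
  · intro h
    obtain ⟨a, rfl⟩ := IsDiscreteValuationRing.exists_lift_of_le_one h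
    exact a.2
  · intro h
    exact IsDedekindDomain.HeightOneSpectrum.valuation_le_one _
      (⟨x, h⟩ : (absValuation p K).valuationSubring)

-- Both valuations have the same valuation ring, so passing to quotients they induce the same order;
-- this transfers the metric topology to `normVal`.
variable {K} in
theorem normVal_le_normVal_iff (x y : K) :
    normVal p K x ≤ normVal p K y ↔ spectralNorm ℚ_[p] K x ≤ spectralNorm ℚ_[p] K y := by
  let : NontriviallyNormedField K := spectralNorm.nontriviallyNormedField ℚ_[p] K
  rcases eq_or_ne y 0 with rfl | hy
  · have : spectralNorm ℚ_[p] K x ≤ spectralNorm ℚ_[p] K 0 ↔ ‖x‖ ≤ ‖(0 : K)‖ := Iff.rfl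
    rw [this]
    simp
  · have hy0 : 0 < normVal p K y := zero_lt_iff.2 ((normVal p K).ne_zero_iff.2 hy)
    have h1 := normVal_le_one_iff p (x / y)
    have h2 : spectralNorm ℚ_[p] K (x / y) = ‖x‖ / ‖y‖ := norm_div x y
    rw [map_div₀, div_le_one₀ hy0, h2, div_le_one₀ (norm_pos_iff.2 hy)] at h1
    exact h1

/-- The valuation ring is compact and its maximal ideal open, so the residue field is finite; its
order is the required `q`. -/
theorem exists_card_residue : ∃ q : ℕ, 2 ≤ q ∧ normVal p K (q : K) < 1 ∧
    ∀ x, normVal p K x ≤ 1 → normVal p K (x ^ q - x) < 1 := by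
  let : NontriviallyNormedField K := spectralNorm.nontriviallyNormedField ℚ_[p] K
  let : NormedAlgebra ℚ_[p] K := spectralNorm.normedAlgebra ℚ_[p] K
  have : IsUltrametricDist K :=
    IsUltrametricDist.isUltrametricDist_of_isNonarchimedean_norm isNonarchimedean_spectralNorm
  have : ProperSpace K := FiniteDimensional.proper ℚ_[p] K
  set A := (absValuation p K).valuationSubring with hA
  have hcomp : CompactSpace A := by
    refine isCompact_iff_compactSpace.mp (?_ : IsCompact (A : Set K))
    have : (A : Set K) = Metric.closedBall 0 1 := by
      ext x
      rw [mem_closedBall_zero_iff]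
      exact Iff.rfl
    rw [this]
    exact isCompact_closedBall 0 1
  have hmem : ∀ a : A, a ∈ IsLocalRing.maximalIdeal A ↔ ‖(a : K)‖ < 1 := by
    intro a
    rw [ValuationSubring.valuation_lt_one_iff]
    exact ((absValuation p K).isEquiv_valuation_valuationSubring.lt_one_iff_lt_one).symm
  have hlt : ∀ a : A, a ∈ IsLocalRing.maximalIdeal A → normVal p K (a : K) < 1 := fun a ha =>
    (IsDedekindDomain.HeightOneSpectrum.valuation_lt_one_iff_mem
      (IsDiscreteValuationRing.maximalIdeal A) a).2 ha
  have hopen : IsOpen ((IsLocalRing.maximalIdeal A).toAddSubgroup : Set A) := by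
    have : ((IsLocalRing.maximalIdeal A).toAddSubgroup : Set A) = {a : A | ‖(a : K)‖ < 1} := by
      ext a; exact hmem a
    rw [this]
    exact isOpen_lt (by fun_prop) continuous_const
  have hfin : Finite (IsLocalRing.ResidueField A) :=
    AddSubgroup.quotient_finite_of_isOpen _ hopen
  have := Fintype.ofFinite (IsLocalRing.ResidueField A)
  refine ⟨Fintype.card (IsLocalRing.ResidueField A), Fintype.one_lt_card, ?_, fun x hx => ?_⟩
  · refine hlt (Fintype.card (IsLocalRing.ResidueField A) : A) ?_
    rw [← IsLocalRing.residue_eq_zero_iff, map_natCast, Nat.cast_card_eq_zero]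
  · obtain ⟨a, rfl⟩ := IsDiscreteValuationRing.exists_lift_of_le_one hx
    refine hlt (a ^ Fintype.card (IsLocalRing.ResidueField A) - a) ?_
    rw [← IsLocalRing.residue_eq_zero_iff, map_sub, map_pow, FiniteField.pow_card, sub_self]

variable {K} in
theorem exists_padicLike {π : K} (hπ : ord p K π = 1) :
    ∃ q : ℕ, PadicLike (normVal p K) π q := by
  obtain ⟨q, h2, hq, hfrob⟩ := exists_card_residue p K
  have hlog : WithZero.log (normVal p K π) = -1 := by
    have : -WithZero.log (normVal p K π) = 1 := hπ
    omega
  have hπ1 : normVal p K π = WithZero.exp (-1) := by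
    rw [← hlog, WithZero.exp_log]
    intro h0
    rw [h0, WithZero.log_zero] at hlog
    omega
  refine ⟨q, hπ1, h2, hq, hfrob, fun u f hf hc => ?_⟩
  let : NontriviallyNormedField K := spectralNorm.nontriviallyNormedField ℚ_[p] K
  let : NormedAlgebra ℚ_[p] K := spectralNorm.normedAlgebra ℚ_[p] K
  have : ProperSpace K := FiniteDimensional.proper ℚ_[p] K
  have hle : ∀ x y : K, normVal p K x ≤ normVal p K y ↔ ‖x‖ ≤ ‖y‖ := normVal_le_normVal_iff p
  have hlt : ∀ x : K, normVal p K x < 1 ↔ ‖x‖ ≤ ‖π‖ := fun x => by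
    rw [← PadicLike.le_exp_neg_one_iff, ← hπ1, hle]
  -- By discreteness, the open residue disc is the closed ball of radius `‖π‖`, hence complete, and
  -- Banach's fixed point theorem applies.
  have hball : ∀ z : K, z ∈ Metric.closedBall u ‖π‖ ↔ normVal p K (z - u) < 1 := fun z => by
    rw [hlt, mem_closedBall_iff_norm]
  have hmaps : MapsTo f (Metric.closedBall u ‖π‖) (Metric.closedBall u ‖π‖) := fun z hz => by
    rw [hball] at hz ⊢
    exact hf z hz
  have hπlt : ‖π‖₊ < 1 := by
    have h1 := hle 1 π
    rw [map_one, hπ1, PadicLike.le_exp_neg_one_iff] at h1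
    have h3 := mt h1.2 (lt_irrefl _)
    rw [not_le, norm_one] at h3
    exact h3
  have hcontr : ContractingWith ‖π‖₊ (hmaps.restrict f _ _) := by
    refine ⟨hπlt, LipschitzWith.of_dist_le_mul fun z w => ?_⟩
    have h1 := hc z w ((hball _).1 z.2) ((hball _).1 w.2)
    rw [← hπ1, ← map_mul, hle, norm_mul] at h1
    rw [Subtype.dist_eq, Subtype.dist_eq, dist_eq_norm, dist_eq_norm]
    exact h1
  obtain ⟨y, hy, hfy, -⟩ := ContractingWith.exists_fixedPoint' Metric.isClosed_closedBall.isComplete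
    hmaps hcontr (Metric.mem_closedBall_self (norm_nonneg π)) (edist_ne_top _ _)
  exact ⟨y, (hball y).1 hy, hfy⟩

end LocalField

/-! ### Definability of the sets and of the valuation modulo `d` -/

namespace PadicLike

variable {K : Type*} [Field K] {v : Valuation K ℤᵐ⁰} {π : K} {q : ℕ} (h : PadicLike v π q)

section DefinableSets

variable {α : Type} {f : (α → K) → K}

include h

theorem defPred_map_le_one (hf : TermFun π f) : DefPred π (fun w => v (f w) ≤ 1) := by
  refine DefPred.congr (DefPred.ex ?_) fun w => h.mem_valRing_iff (f w)
  exact DefPred.eq ((TermFun.var _).pow _)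
    (TermFun.one.add (TermFun.unif.mul ((hf.comp Sum.inl).pow _)))

theorem defPred_mem_natSpan_units (hf : TermFun π f) :
    DefPred π (fun w => f w ∈ natSpan π {u | v u = 1}) := by
  rw [h.natSpan_units]
  exact (h.defPred_map_le_one hf).and (DefPred.eq hf TermFun.zero).not

theorem defPred_mem_natSpan_higherUnits (k : ℕ) (hf : TermFun π f) :
    DefPred π (fun w => f w ∈ natSpan π {u | v (u - 1) ≤ WithZero.exp (-((k + 1 : ℕ) : ℤ))}) := by
  refine DefPred.congr ?_ fun w => h.mem_natSpan_higherUnits_iff k (f w)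
  refine (h.defPred_map_le_one hf).and ((DefPred.eq hf TermFun.zero).not.and
    (DefPred.exists_lt (fun i => DefPred.ex (DefPred.ex ?_)) _))
  refine (h.defPred_map_le_one (TermFun.var _)).and (DefPred.eq
    ((hf.comp Sum.inl).comp Sum.inl) ?_)
  exact ((TermFun.one.add ((TermFun.unif.pow _).mul (TermFun.var _))).mul (TermFun.unif.pow _)).mul
    (((TermFun.var (Sum.inr ())).comp Sum.inl).pow _)

omit h in
/-- The valuation of `x` is congruent to `r` modulo `d`. -/
def _root_.OrdModEq {K : Type*} [Field K] (v : Valuation K ℤᵐ⁰) (π : K) (d r : ℕ) (x : K) : Prop :=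
  ∃ z a b, v a ≤ 1 ∧ v b ≤ 1 ∧ a * b = 1 ∧ x = π ^ r * z ^ d * a

theorem defPred_ordModEq (d r : ℕ) (hf : TermFun π f) :
    DefPred π (fun w => OrdModEq v π d r (f w)) := by
  refine DefPred.ex (DefPred.ex (DefPred.ex ?_))
  refine (h.defPred_map_le_one ((TermFun.var (Sum.inr ())).comp Sum.inl)).and
    ((h.defPred_map_le_one (TermFun.var _)).and ((DefPred.eq
      (((TermFun.var (Sum.inr ())).comp Sum.inl).mul (TermFun.var _)) TermFun.one).and
      (DefPred.eq (((hf.comp Sum.inl).comp Sum.inl).comp Sum.inl) ?_)))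
  exact ((TermFun.unif.pow _).mul ((((TermFun.var (Sum.inr ())).comp Sum.inl).comp Sum.inl).pow _)).mul
    ((TermFun.var (Sum.inr ())).comp Sum.inl)

end DefinableSets

include h in
theorem ordModEq_iff {d r m : ℕ} (hr : r < d) {u : K} (hu : v u = 1) :
    OrdModEq v π d r (π ^ m * u) ↔ m % d = r := by
  have hu0 : u ≠ 0 := by rw [← v.ne_zero_iff, hu]; exact one_ne_zero
  constructor
  · rintro ⟨z, a, b, ha, hb, hab, hx⟩
    have ha1 : v a = 1 := by
      refine ha.antisymm ?_
      have := congrArg v hab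
      rw [map_mul, map_one] at this
      rw [← this]
      exact mul_le_of_le_one_right' hb
    have hz : z ≠ 0 := by
      rintro rfl
      rw [zero_pow (by omega), mul_zero, zero_mul] at hx
      exact mul_ne_zero (pow_ne_zero _ h.unif_ne_zero) hu0 hx
    obtain ⟨j, w, hw, rfl⟩ := h.exists_eq_zpow_mul hz
    -- Comparing valuations gives `m = r + j * d`; the exponent `j` may be any integer.
    have h1 : π ^ (m : ℤ) * u = π ^ ((r : ℤ) + j * d) * (w ^ d * a) := by
      rw [zpow_add₀ h.unif_ne_zero, zpow_mul, zpow_natCast, zpow_natCast, zpow_natCast, hx, mul_pow]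
      ring
    have h2 := h.log_zpow_mul m hu
    rw [h1, h.log_zpow_mul _ (by rw [map_mul, map_pow, hw, ha1, one_pow, one_mul])] at h2
    have h3 : ((m % d : ℕ) : ℤ) = (r : ℕ) := by
      rw [Int.natCast_mod, ← h2, Int.add_mul_emod_self_right]
      exact Int.emod_eq_of_lt (by omega) (by omega)
    exact_mod_cast h3
  · rintro rfl
    refine ⟨π ^ (m / d), u, u⁻¹, hu.le, ?_, mul_inv_cancel₀ hu0, ?_⟩
    · rw [map_inv₀, hu, inv_one]
    · rw [← pow_mul, ← pow_add, mul_comm (m / d), Nat.mod_add_div]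

include h in
theorem unif_pow_mul_inj {m m' : ℕ} {u u' : K} (hu : v u = 1) (hu' : v u' = 1)
    (heq : π ^ m * u = π ^ m' * u') : m = m' ∧ u = u' := by
  have h1 := h.log_zpow_mul m hu
  have h2 := h.log_zpow_mul m' hu'
  rw [zpow_natCast] at h1 h2
  rw [heq, h2] at h1
  obtain rfl : m = m' := by omega
  exact ⟨rfl, mul_left_cancel₀ (pow_ne_zero _ h.unif_ne_zero) heq⟩

/-! ### The folding map -/

open Classical in
/-- A bijection from two copies of `natSpan π G` (with `j = 0` and `j = 1`) to `natSpan π G`, for a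
group `G` of units on which `u ↦ u ^ (d + 1)` is bijective. -/
noncomputable def _root_.foldMap {K : Type*} [Field K] (v : Valuation K ℤᵐ⁰) (π : K) (d : ℕ)
    (j y : K) : K :=
  if j = 0 then y ^ (d + 1) / π ^ ((-WithZero.log (v y)).toNat % d)
  else if (-WithZero.log (v y)).toNat % d = 0 then y ^ (d + 1) * π ^ (d * d)
  else y

section FoldMap

variable {d : ℕ}

include h

theorem log_toNat {m : ℕ} {u : K} (hu : v u = 1) :
    (-WithZero.log (v (π ^ m * u))).toNat = m := by
  have := h.log_zpow_mul m hu
  rw [zpow_natCast] at this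
  rw [this, Int.toNat_natCast]

theorem foldMap_zero {m : ℕ} {u : K} (hu : v u = 1) :
    foldMap v π d 0 (π ^ m * u) = π ^ (d * ((d + 1) * (m / d) + m % d)) * u ^ (d + 1) := by
  rw [foldMap, if_pos rfl, h.log_toNat hu, div_eq_iff (pow_ne_zero _ h.unif_ne_zero), mul_pow,
    ← pow_mul]
  -- Division of `m` by `d`: the factor `d + 1` preserves the residue, so subtracting `m % d` leaves
  -- a multiple of `d`.
  have : m * (d + 1) = d * ((d + 1) * (m / d) + m % d) + m % d := by
    conv_lhs => rw [← Nat.div_add_mod m d]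
    ring
  rw [this, pow_add]
  ring

theorem foldMap_one_of_dvd {m : ℕ} (hm : m % d = 0) {u : K} (hu : v u = 1) :
    foldMap v π d 1 (π ^ m * u) = π ^ (d * ((d + 1) * (m / d) + d)) * u ^ (d + 1) := by
  rw [foldMap, if_neg one_ne_zero, h.log_toNat hu, if_pos hm, mul_pow, ← pow_mul]
  have : d * ((d + 1) * (m / d) + d) = m * (d + 1) + d * d := by
    conv_rhs => rw [← Nat.div_add_mod m d, hm]
    ring
  rw [this, pow_add]
  ring

theorem foldMap_one_of_not_dvd {m : ℕ} (hm : m % d ≠ 0) {u : K} (hu : v u = 1) :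
    foldMap v π d 1 (π ^ m * u) = π ^ m * u := by
  rw [foldMap, if_neg one_ne_zero, h.log_toNat hu, if_neg hm]

/-- The right side eliminates the valuation and the division: the residue `r` ranges over a finite
list and is tested by `OrdModEq`, so the graph becomes first-order. -/
theorem eq_foldMap_iff (hd : 0 < d) {G : Set K} (hG : ∀ u ∈ G, v u = 1) (j : K) {x : K} (y : K)
    (hx : x ∈ natSpan π G) :
    ((j = 0 ∨ j = 1) ∧ y = foldMap v π d j x) ↔
      (j = 0 ∧ ∃ r < d, OrdModEq v π d r x ∧ π ^ r * y = x ^ (d + 1)) ∨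
      (j = 1 ∧ ((OrdModEq v π d 0 x ∧ y = x ^ (d + 1) * π ^ (d * d)) ∨
        (¬ OrdModEq v π d 0 x ∧ y = x))) := by
  obtain ⟨m, u, hu, rfl⟩ := hx
  have hu1 := hG u hu
  have hmod : (-WithZero.log (v (π ^ m * u))).toNat % d = m % d := by rw [h.log_toNat hu1]
  rw [or_and_right]
  refine or_congr (and_congr_right ?_) (and_congr_right ?_)
  · rintro rfl
    rw [foldMap, if_pos rfl, hmod, eq_div_iff (pow_ne_zero _ h.unif_ne_zero), mul_comm]
    constructor
    · intro hy
      exact ⟨m % d, Nat.mod_lt _ hd, (h.ordModEq_iff (Nat.mod_lt _ hd) hu1).2 rfl, hy⟩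
    · rintro ⟨r, hr, hmr, hy⟩
      rw [h.ordModEq_iff hr hu1] at hmr
      rw [hmr, hy]
  · rintro rfl
    rw [foldMap, if_neg one_ne_zero, hmod, h.ordModEq_iff hd hu1]
    split_ifs with h0 <;> simp [h0]

end FoldMap

/-- `G` is a set of units on which raising to the power `n` is surjective. -/
structure _root_.PowSurjOn {K : Type*} [Field K] (v : Valuation K ℤᵐ⁰) (n : ℕ) (G : Set K) :
    Prop where
  map_eq_one : ∀ u ∈ G, v u = 1
  pow_mem : ∀ u ∈ G, u ^ n ∈ G
  exists_root : ∀ u ∈ G, ∃ z ∈ G, z ^ n = u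

include h in
theorem powSurjOn_units : PowSurjOn v (2 * q - 1) {u | v u = 1} where
  map_eq_one _ hu := hu
  pow_mem u hu := by
    rw [Set.mem_ofPred_eq, map_pow, show v u = 1 from hu, one_pow]
  exists_root u hu := by
    obtain ⟨z, hz, hzu⟩ := h.exists_root hu
    exact ⟨z, map_eq_one_of_sub_lt v hu hz, hzu⟩

-- The power map is an isometry near 1, so it preserves the distance to 1. The root of `u` found in
-- the residue disc of `u` therefore has the same distance to 1 as `u`.
include h in
theorem powSurjOn_higherUnits {k : ℕ} (hk : 0 < k) :
    PowSurjOn v (2 * q - 1) {u | v (u - 1) ≤ WithZero.exp (-(k : ℤ))} := by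
  have hlt : ∀ u : K, v (u - 1) ≤ WithZero.exp (-(k : ℤ)) → v (u - 1) < 1 := by
    intro u hu
    refine hu.trans_lt ?_
    rw [← WithZero.exp_zero, WithZero.exp_lt_exp]; omega
  have key : ∀ u : K, v (u - 1) < 1 → v (u ^ (2 * q - 1) - 1) = v (u - 1) := by
    intro u hu
    have := map_pow_sub_pow_eq v h.map_exponent (w := 1) (by simp) hu
    rwa [one_pow] at this
  refine ⟨fun u hu => map_eq_one_of_sub_one_le hk hu, fun u hu => ?_, fun u hu => ?_⟩
  · rw [Set.mem_ofPred_eq, key u (hlt u hu)]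
    exact hu
  · obtain ⟨z, hz, rfl⟩ := h.exists_root (map_eq_one_of_sub_one_le hk hu)
    refine ⟨z, ?_, rfl⟩
    have hz1 := sub_lt_one_trans v hz (hlt _ hu)
    have hu' : v (z ^ (2 * q - 1) - 1) ≤ WithZero.exp (-(k : ℤ)) := hu
    rwa [key z hz1] at hu'

/-! ### Bijectivity of the folding map -/

section Bijection

variable {d : ℕ} (hqd : 2 * q - 1 = d + 1) {G : Set K} (hG : PowSurjOn v (d + 1) G)

theorem _root_.Nat.mul_add_inj_of_lt {n a b r s : ℕ} (hr : r < n) (hs : s < n)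
    (hab : n * a + r = n * b + s) : a = b ∧ r = s := by
  have h1 := congrArg (· / n) hab
  have h2 := congrArg (· % n) hab
  simp only [Nat.mul_add_div (by omega : 0 < n), Nat.div_eq_of_lt hr, Nat.div_eq_of_lt hs,
    Nat.mul_add_mod, Nat.mod_eq_of_lt hr, Nat.mod_eq_of_lt hs] at h1 h2
  exact ⟨h1, h2⟩

include h hG

theorem foldMap_mem {j x : K} (hj : j = 0 ∨ j = 1) (hx : x ∈ natSpan π G) :
    foldMap v π d j x ∈ natSpan π G := by
  obtain ⟨m, u, hu, rfl⟩ := hx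
  have hu1 := hG.map_eq_one u hu
  rcases hj with rfl | rfl
  · rw [h.foldMap_zero hu1]
    exact ⟨_, _, hG.pow_mem u hu, rfl⟩
  · by_cases hm : m % d = 0
    · rw [h.foldMap_one_of_dvd hm hu1]
      exact ⟨_, _, hG.pow_mem u hu, rfl⟩
    · rw [h.foldMap_one_of_not_dvd hm hu1]
      exact ⟨_, _, hu, rfl⟩

theorem exists_foldMap_eq (hd : 0 < d) {y : K} (hy : y ∈ natSpan π G) :
    ∃ j x, (j = 0 ∨ j = 1) ∧ x ∈ natSpan π G ∧ foldMap v π d j x = y := by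
  obtain ⟨m, u, hu, rfl⟩ := hy
  by_cases hm : m % d = 0
  · obtain ⟨z, hz, rfl⟩ := hG.exists_root u hu
    have hz1 := hG.map_eq_one z hz
    have hm' : m = d * ((d + 1) * (m / d / (d + 1)) + m / d % (d + 1)) := by
      rw [Nat.div_add_mod, ← Nat.div_add_mod m d, hm, Nat.add_zero, Nat.mul_div_cancel_left _ hd]
    -- The residue of `m / d` mod `d + 1` decides the copy: below `d` it is a remainder mod `d`
    -- coming from copy 0, and the one remaining value `d` comes from copy 1.
    rcases Nat.lt_succ_iff_lt_or_eq.1 (Nat.mod_lt (m / d) (by omega : 0 < d + 1)) with hr | hr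
    · refine ⟨0, π ^ (d * (m / d / (d + 1)) + m / d % (d + 1)) * z, Or.inl rfl,
        ⟨_, _, hz, rfl⟩, ?_⟩
      rw [h.foldMap_zero hz1, Nat.mul_add_div hd, Nat.div_eq_of_lt hr, Nat.mul_add_mod,
        Nat.mod_eq_of_lt hr, add_zero, ← hm']
    · refine ⟨1, π ^ (d * (m / d / (d + 1))) * z, Or.inr rfl, ⟨_, _, hz, rfl⟩, ?_⟩
      rw [h.foldMap_one_of_dvd (Nat.mul_mod_right _ _) hz1, Nat.mul_div_cancel_left _ hd]
      rw [show m / d % (d + 1) = d from hr] at hm'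
      rw [← hm']
  · exact ⟨1, _, Or.inr rfl, ⟨m, u, hu, rfl⟩,
      h.foldMap_one_of_not_dvd hm (hG.map_eq_one u hu)⟩

include hqd

/-- The three branches have disjoint images, told apart by whether `d` divides the exponent and, if
so, by whether the quotient is `d` mod `d + 1`. Within a branch, the exponent recovers `m` and
injectivity of the power map on units recovers `u`. -/
theorem foldMap_inj (hd : 0 < d) {j x j' x' : K} (hj : j = 0 ∨ j = 1) (hj' : j' = 0 ∨ j' = 1)
    (hx : x ∈ natSpan π G) (hx' : x' ∈ natSpan π G)
    (heq : foldMap v π d j x = foldMap v π d j' x') : j = j' ∧ x = x' := by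
  obtain ⟨m, u, hu, rfl⟩ := hx
  obtain ⟨m', u', hu', rfl⟩ := hx'
  have h1 := hG.map_eq_one u hu
  have h1' := hG.map_eq_one u' hu'
  have hp : ∀ w : K, v w = 1 → v (w ^ (d + 1)) = 1 := fun w hw => by rw [map_pow, hw, one_pow]
  have hinj : ∀ w w' : K, v w = 1 → v w' = 1 → w ^ (d + 1) = w' ^ (d + 1) → w = w' := by
    intro w w' hw hw' hww
    rw [← hqd] at hww
    exact h.pow_exponent_injOn hw hw' hww
  have hrec : ∀ {a r a' r' : ℕ}, r < d + 1 → r' < d + 1 →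
      π ^ (d * ((d + 1) * a + r)) * u ^ (d + 1) = π ^ (d * ((d + 1) * a' + r')) * u' ^ (d + 1) →
      a = a' ∧ r = r' ∧ u = u' := by
    intro a r a' r' hr hr' he
    obtain ⟨e1, e2⟩ := h.unif_pow_mul_inj (hp u h1) (hp u' h1') he
    obtain ⟨e3, e4⟩ := Nat.mul_add_inj_of_lt hr hr' (Nat.eq_of_mul_eq_mul_left hd e1)
    exact ⟨e3, e4, hinj u u' h1 h1' e2⟩
  have hlt : m % d < d := Nat.mod_lt _ hd
  have hlt' : m' % d < d := Nat.mod_lt _ hd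
  have hm_eq : m / d = m' / d → m % d = m' % d → m = m' := fun e1 e2 => by
    rw [← Nat.div_add_mod m d, e1, e2, Nat.div_add_mod]
  rcases hj with rfl | rfl <;> rcases hj' with rfl | rfl
  · rw [h.foldMap_zero h1, h.foldMap_zero h1'] at heq
    obtain ⟨e1, e2, rfl⟩ := hrec (by omega) (by omega) heq
    rw [hm_eq e1 e2]
    exact ⟨rfl, rfl⟩
  · exfalso
    rw [h.foldMap_zero h1] at heq
    by_cases hm' : m' % d = 0
    · rw [h.foldMap_one_of_dvd hm' h1'] at heq
      obtain ⟨-, e2, -⟩ := hrec (by omega) (by omega) heq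
      omega
    · rw [h.foldMap_one_of_not_dvd hm' h1'] at heq
      obtain ⟨e1, -⟩ := h.unif_pow_mul_inj (hp u h1) h1' heq
      exact hm' (by rw [← e1, Nat.mul_mod_right])
  · exfalso
    rw [h.foldMap_zero h1'] at heq
    by_cases hm : m % d = 0
    · rw [h.foldMap_one_of_dvd hm h1] at heq
      obtain ⟨-, e2, -⟩ := hrec (by omega) (by omega) heq
      omega
    · rw [h.foldMap_one_of_not_dvd hm h1] at heq
      obtain ⟨e1, -⟩ := h.unif_pow_mul_inj h1 (hp u' h1') heq
      exact hm (by rw [e1, Nat.mul_mod_right])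
  · refine ⟨rfl, ?_⟩
    by_cases hm : m % d = 0 <;> by_cases hm' : m' % d = 0
    · rw [h.foldMap_one_of_dvd hm h1, h.foldMap_one_of_dvd hm' h1'] at heq
      obtain ⟨e1, -, rfl⟩ := hrec (by omega) (by omega) heq
      rw [hm_eq e1 (hm.trans hm'.symm)]
    · rw [h.foldMap_one_of_dvd hm h1, h.foldMap_one_of_not_dvd hm' h1'] at heq
      obtain ⟨e1, -⟩ := h.unif_pow_mul_inj (hp u h1) h1' heq
      exact absurd (by rw [← e1, Nat.mul_mod_right]) hm'
    · rw [h.foldMap_one_of_not_dvd hm h1, h.foldMap_one_of_dvd hm' h1'] at heq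
      obtain ⟨e1, -⟩ := h.unif_pow_mul_inj h1 (hp u' h1') heq
      exact absurd (by rw [e1, Nat.mul_mod_right]) hm
    · rwa [h.foldMap_one_of_not_dvd hm h1, h.foldMap_one_of_not_dvd hm' h1'] at heq

end Bijection

/-! ### The definable isomorphism and the two cases -/

include h in
theorem isomorphic_twoCopies {G : Set K} (hG : PowSurjOn v (2 * q - 1) G)
    (hdef : ∀ {α : Type} {f : (α → K) → K}, TermFun π f →
      DefPred π (fun w => f w ∈ natSpan π G)) :
    letI : ringConst.Structure K := ringConstStructure π
    Isomorphic ringConst (twoCopies (asPower (natSpan π G))) (asPower (natSpan π G)) := by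
  have h2 := h.two_le
  obtain ⟨d, hqd⟩ : ∃ d, 2 * q - 1 = d + 1 := ⟨2 * q - 2, by omega⟩
  have hd : 0 < d := by omega
  rw [hqd] at hG
  refine ⟨?_, hdef (TermFun.var 0), fun x => ⟨fun _ => foldMap v π d (x.1 0) (x.1 1),
    h.foldMap_mem hG x.2.1 x.2.2⟩, ⟨fun x y hxy => ?_, fun y => ?_⟩, ?_⟩
  · exact ((DefPred.eq (TermFun.var 0) TermFun.zero).or
      (DefPred.eq (TermFun.var 0) TermFun.one)).and (hdef (TermFun.var 1))
  · have heq : foldMap v π d (x.1 0) (x.1 1) = foldMap v π d (y.1 0) (y.1 1) :=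
      congrFun (congrArg Subtype.val hxy) 0
    obtain ⟨e0, e1⟩ := h.foldMap_inj hqd hG hd x.2.1 y.2.1 x.2.2 y.2.2 heq
    refine Subtype.ext (funext fun i => ?_)
    fin_cases i
    · exact e0
    · exact e1
  · obtain ⟨j, x, hj, hx, hy⟩ := h.exists_foldMap_eq hG hd y.2
    refine ⟨⟨![j, x], hj, hx⟩, Subtype.ext (funext fun i => ?_)⟩
    fin_cases i
    exact hy
  -- In `K^3` the coordinates are the copy index, the argument and the value.
  · refine DefPred.congr (π := π) (P := fun z : Fin (1 + 1 + 1) → K => z 1 ∈ natSpan π G ∧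
      ((z 0 = 0 ∧ ∃ r < d, OrdModEq v π d r (z 1) ∧ π ^ r * z 2 = z 1 ^ (d + 1)) ∨
      (z 0 = 1 ∧ ((OrdModEq v π d 0 (z 1) ∧ z 2 = z 1 ^ (d + 1) * π ^ (d * d)) ∨
        (¬ OrdModEq v π d 0 (z 1) ∧ z 2 = z 1))))) ?_ fun z => ?_
    · have v1 : TermFun π (fun w : Fin (1 + 1 + 1) → K => w 1) := TermFun.var 1
      have v2 : TermFun π (fun w : Fin (1 + 1 + 1) → K => w 2) := TermFun.var 2
      have ho := h.defPred_ordModEq d 0 v1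
      refine (hdef v1).and (((DefPred.eq (TermFun.var 0) TermFun.zero).and
        (DefPred.exists_lt (fun r => ?_) d)).or ((DefPred.eq (TermFun.var 0) TermFun.one).and
        ((ho.and (DefPred.eq v2 ((v1.pow _).mul (TermFun.unif.pow _)))).or
          (ho.not.and (DefPred.eq v2 v1)))))
      exact (h.defPred_ordModEq d r v1).and (DefPred.eq ((TermFun.unif.pow _).mul v2) (v1.pow _))
    · constructor
      · rintro ⟨x, rfl⟩
        exact ⟨x.2.2, (h.eq_foldMap_iff hd hG.map_eq_one _ _ x.2.2).1 ⟨x.2.1, rfl⟩⟩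
      · rintro ⟨hz, hz'⟩
        obtain ⟨hj, hy⟩ := (h.eq_foldMap_iff hd hG.map_eq_one _ _ hz).2 hz'
        refine ⟨⟨![z 0, z 1], hj, hz⟩, funext fun i => ?_⟩
        fin_cases i
        · rfl
        · rfl
        · exact hy

end PadicLike

theorem mainTheorem4 (p : ℕ) [Fact p.Prime] (K : Type*) [Field K] [Algebra ℚ_[p] K]
    [FiniteDimensional ℚ_[p] K] (π : K) (hπ : ord p K π = 1) :
    letI : ringConst.Structure K := ringConstStructure π
    (∀ k : ℕ, 0 < k →
      Isomorphic ringConst (twoCopies (asPower (higher p π (valRing p K) k)))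
        (asPower (higher p π (valRing p K) k))) ∧
    Isomorphic ringConst (twoCopies (asPower (valRingStar p K))) (asPower (valRingStar p K)) := by
  obtain ⟨q, h⟩ := exists_padicLike p hπ
  refine ⟨fun k hk => ?_, ?_⟩
  · have hset : higher p π (valRing p K) k =
        natSpan π {u | normVal p K (u - 1) ≤ WithZero.exp (-(k : ℤ))} := by
      rw [h.natSpan_higherUnits hk]
      ext x
      simp only [higher, ord, neg_neg]
      exact Iff.rfl
    -- The definability lemma is indexed from level `k + 1`, as `(q - 1) * q ^ k` is the exponent
    -- used for that level.
    obtain ⟨k, rfl⟩ : ∃ l, k = l + 1 := ⟨k - 1, by omega⟩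
    rw [hset]
    exact h.isomorphic_twoCopies (h.powSurjOn_higherUnits hk)
      (h.defPred_mem_natSpan_higherUnits k)
  · have hset : valRingStar p K = natSpan π {u | normVal p K u = 1} := by
      rw [h.natSpan_units]
      rfl
    rw [hset]
    exact h.isomorphic_twoCopies h.powSurjOn_units h.defPred_mem_natSpan_units
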